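/- For complex $x,q$ with $|q|<1$ let $(x;q)_n=\prod_{j=0}^{n-1}(1-xq^j)$, $(x;q)_\infty=\prod_{j=0}^{\infty}(1-xq^j)$, and $(x_1,\dots,x_m;q)_n=\prod_{i=1}^m (x_i;q)_n$ for $n\in\{0,1,2,\dots\}\cup\{\infty\}$. Define $$f(a,k,z,q)=\sum_{n=1}^{\infty}\frac{(q\sqrt{k},-q\sqrt{k},k,z,k/a;q)_n}{(\sqrt{k},-\sqrt{k},qk,qk/z,qa;q)_n\,(1-q^n)}\left(\frac{qa}{z}\right)^n$$ (the choice of the square root is immaterial). Let $a,k,z,q\in\mathbb{C}$ with $0<|q|<1$, $k\neq 0$ and $|qa|<|z|<|a/q|$ (so that $a,z\ne0$), and suppose that none of the denominators below vanish, that is, none of $a,\ k,\ z/k,\ z/a$ is an integer power of $q$. Then the series defining $f(a,k,z,q)$ and $f(1/a,1/k,1/z,q)$ converge absolutely, and $$f(a,k,z,q)-f\left(\frac1a,\frac1k,\frac1z,q\right)=\frac{(a-k)(1-1/z)(1-ak/z)}{(1-a)(1-k)(1-a/z)(1-k/z)}+\frac{z}{k}\,\frac{(z,\,q/z,\,k/a,\,qa/k,\,ak/z,\,qz/(ak),\,q,\,q;q)_\infty}{(z/k,\,qk/z,\,z/a,\,qa/z,\,a,\,q/a,\,k,\,q/k;q)_\infty}.$$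 -/

import Mathlib

/-- The finite `q`-shifted factorial `(a; q)_n = (1 - a) (1 - a q) ⋯ (1 - a q ^ (n - 1))`. -/
noncomputable def qPoch (a q : ℂ) (n : ℕ) : ℂ :=
  ∏ j ∈ Finset.range n, (1 - a * q ^ j)

/-- The infinite `q`-shifted factorial `(a; q)_∞ = (1 - a) (1 - a q) (1 - a q ^ 2) ⋯`. -/
noncomputable def qPochInf (a q : ℂ) : ℂ :=
  ∏' j : ℕ, (1 - a * q ^ j)

/-- For `|q| < 1` the product defining `(a; q)_∞` converges. -/
theorem qPochInf_multipliable (a q : ℂ) (hq : ‖q‖ < 1) :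
    Multipliable (fun j : ℕ => 1 - a * q ^ j) := by
  have h : Summable fun j : ℕ => ‖-(a * q ^ j)‖ := by
    simpa [norm_mul, norm_pow] using
      (summable_geometric_of_lt_one (norm_nonneg q) hq).mul_left ‖a‖
  simpa [sub_eq_add_neg] using multipliable_one_add_of_summable h

/-- `(a₁, a₂, …, aⱼ; q)_n = (a₁; q)_n (a₂; q)_n ⋯ (aⱼ; q)_n`. -/
noncomputable def qPochs (l : List ℂ) (q : ℂ) (n : ℕ) : ℂ :=
  (l.map fun a => qPoch a q n).prod

/-- `(a₁, a₂, …, aⱼ; q)_∞ = (a₁; q)_∞ (a₂; q)_∞ ⋯ (aⱼ; q)_∞`. -/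
noncomputable def qPochsInf (l : List ℂ) (q : ℂ) : ℂ :=
  (l.map fun a => qPochInf a q).prod

/-- The `n`-th term (`n ≥ 1`) of the very-well-poised series `f(a, k, z, q)`. Both square roots of
`k` enter symmetrically, so the choice of branch does not matter. -/
noncomputable def fTerm (a k z q : ℂ) (n : ℕ) : ℂ :=
  qPochs [q * Complex.sqrt k, -(q * Complex.sqrt k), k, z, k / a] q n /
    (qPochs [Complex.sqrt k, -Complex.sqrt k, q * k, q * k / z, q * a] q n * (1 - q ^ n)) *
    (q * a / z) ^ n

/-- The series `f(a, k, z, q)`, summed over `n = 1, 2, 3, …`. -/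
noncomputable def fSeries (a k z q : ℂ) : ℂ :=
  ∑' n : ℕ, fTerm a k z q (n + 1)

/-!
Let `L(x) = ∑_{n ≥ 1} x q ^ n / (1 - x q ^ n)`. The summand of `f(a, k, z, q)` has a Wilf–Zeilberger
certificate for the shift `(a, k) ↦ (a q, k q)`. Iterating the shift sends the series to `0`, and
what is left over telescopes to `f(a, k, z, q) = L(k) + L(a / z) - L(k / z) - L(a)`. In the
difference with `f(1 / a, 1 / k, 1 / z, q)` each `L(x)` is thus paired with `-L(1 / x)`. Up to the
rational term `x / (1 - x)` this pair is `-x θ'(x) / θ(x)` for the theta function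
`θ(x) = (x, q / x; q)_∞`. Replacing `k, a / z, a, k / z` by their multiples by `t` in Weierstrass'
three-term relation between theta functions and differentiating at `t = 1`, where `θ(t)` vanishes,
evaluates the resulting combination of four logarithmic derivatives as a single product. The
three-term relation itself follows from the Jacobi triple product by splitting the product of two
theta series according to the parity of the sum of the two summation indices.
-/

open Asymptotics Filter Topology

section QPoch

variable {q : ℂ} (x : ℂ)

theorem qPoch_succ (n : ℕ) : qPoch x q (n + 1) = qPoch x q n * (1 - x * q ^ n) :=
  Finset.prod_range_succ _ _

@[simp]
theorem qPoch_zero : qPoch x q 0 = 1 := Finset.prod_range_zero _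

theorem qPoch_add (m n : ℕ) : qPoch x q (m + n) = qPoch x q m * qPoch (x * q ^ m) q n := by
  simp only [qPoch, Finset.prod_range_add, pow_add, mul_assoc]

theorem one_sub_mul_qPoch_mul (n : ℕ) :
    (1 - x) * qPoch (x * q) q n = qPoch x q n * (1 - x * q ^ n) := by
  rw [← qPoch_succ, add_comm n 1, qPoch_add, qPoch_succ]
  simp

theorem pow_succ_ne_one_of_norm_lt_one (hq : ‖q‖ < 1) (n : ℕ) : q ^ (n + 1) ≠ 1 := fun h =>
  (pow_lt_one₀ (norm_nonneg q) hq n.succ_ne_zero).ne (by rw [← norm_pow, h, norm_one])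

theorem mul_pow_mul_pow_succ_ne_one {x : ℂ} (hx : ∀ n : ℕ, x * q ^ (n + 1) ≠ 1) (N n : ℕ) :
    x * q ^ N * q ^ (n + 1) ≠ 1 := by
  simpa only [mul_assoc, ← pow_add, add_assoc] using hx (N + n)

theorem norm_mul_pow_mul_lt_one {x : ℂ} (hq : ‖q‖ < 1) (hx : ‖x * q‖ < 1) (N : ℕ) :
    ‖x * q ^ N * q‖ < 1 := by
  rw [mul_right_comm, norm_mul, norm_pow]
  exact (mul_le_of_le_one_right (norm_nonneg _) (pow_le_one₀ (norm_nonneg q) hq.le)).trans_lt hx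

theorem summable_pow_succ_of_norm_lt_one (hq : ‖q‖ < 1) : Summable fun n : ℕ => q ^ (n + 1) :=
  (summable_nat_add_iff (f := (q ^ ·)) 1).2 (summable_geometric_of_norm_lt_one hq)

theorem tendsto_qPoch (hq : ‖q‖ < 1) : Tendsto (qPoch x q) atTop (𝓝 (qPochInf x q)) :=
  (qPochInf_multipliable x q hq).tendsto_prod_tprod_nat

@[simp]
theorem qPochInf_zero_left : qPochInf 0 q = 1 := by simp [qPochInf]

theorem qPochInf_eq_one_sub_mul (hq : ‖q‖ < 1) : qPochInf x q = (1 - x) * qPochInf (x * q) q := by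
  have hshift (j : ℕ) : 1 - x * q ^ (j + 1) = 1 - x * q * q ^ j := by rw [pow_succ', mul_assoc]
  rw [qPochInf, tprod_eq_zero_mul' (f := fun j : ℕ => 1 - x * q ^ j)
    (by simpa only [hshift] using qPochInf_multipliable (x * q) q hq)]
  simp only [hshift, pow_zero, mul_one, qPochInf]

variable {x}

theorem qPoch_ne_zero (hx : ∀ n : ℕ, x * q ^ n ≠ 1) (n : ℕ) : qPoch x q n ≠ 0 :=
  Finset.prod_ne_zero_iff.2 fun j _ => sub_ne_zero.2 (hx j).symm

theorem qPochInf_eq_zero {n : ℕ} (hx : x * q ^ n = 1) : qPochInf x q = 0 :=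
  tprod_of_exists_eq_zero ⟨n, by rw [hx, sub_self]⟩

theorem qPochInf_ne_zero (hq : ‖q‖ < 1) (hx : ∀ n : ℕ, x * q ^ n ≠ 1) : qPochInf x q ≠ 0 := by
  have hfactor (j : ℕ) : 1 + -(x * q ^ j) ≠ 0 := by
    simpa only [← sub_eq_add_neg, sub_ne_zero] using (hx j).symm
  simpa only [qPochInf, sub_eq_add_neg] using tprod_one_add_ne_zero_of_summable hfactor
    (by simpa using (summable_geometric_of_lt_one (norm_nonneg q) hq).mul_left ‖x‖)

theorem qPochInf_self_ne_zero (hq : ‖q‖ < 1) : qPochInf q q ≠ 0 :=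
  qPochInf_ne_zero hq fun n => by
    simpa only [pow_succ'] using pow_succ_ne_one_of_norm_lt_one hq n

theorem hasProdLocallyUniformlyOn_qPochInf (hq : ‖q‖ < 1) :
    HasProdLocallyUniformlyOn (fun (j : ℕ) (y : ℂ) => 1 - y * q ^ j) (qPochInf · q) Set.univ := by
  refine hasProdLocallyUniformlyOn_of_forall_compact isOpen_univ fun K _ hK => ?_
  obtain ⟨r, hr⟩ := hK.isBounded.exists_norm_le
  have hbound (j : ℕ) (y : ℂ) (hy : y ∈ K) : ‖-(y * q ^ j)‖ ≤ r * ‖q‖ ^ j := by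
    rw [norm_neg, norm_mul, norm_pow]
    gcongr
    exact hr y hy
  simpa only [qPochInf, sub_eq_add_neg] using Summable.hasProdUniformlyOn_nat_one_add hK
    ((summable_geometric_of_lt_one (norm_nonneg q) hq).mul_left r) (.of_forall hbound)
    fun j => by fun_prop

theorem differentiable_qPochInf (hq : ‖q‖ < 1) : Differentiable ℂ (qPochInf · q) :=
  differentiableOn_univ.1 <| TendstoLocallyUniformlyOn.differentiableOn
    (hasProdLocallyUniformlyOn_qPochInf hq) (.of_forall fun s => by fun_prop) isOpen_univ

theorem tendsto_one_sub_mul_pow (x : ℂ) (hq : ‖q‖ < 1) :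
    Tendsto (fun n : ℕ => 1 - x * q ^ n) atTop (𝓝 1) := by
  simpa using ((tendsto_pow_atTop_nhds_zero_of_norm_lt_one hq).const_mul x).const_sub 1

theorem isBigO_top_one_of_tendsto {E : Type*} [NormedAddCommGroup E] {u : ℕ → E} {l : E}
    (hu : Tendsto u atTop (𝓝 l)) :
    u =O[⊤] (1 : ℕ → ℝ) :=
  isBigO_top.2 <| (isBigO_nat_atTop_iff fun _ h => absurd h one_ne_zero).1 (hu.isBigO_one ℝ)

theorem isBigO_inv_one_sub_mul_pow (x : ℂ) (hq : ‖q‖ < 1) :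
    (fun n : ℕ => (1 - x * q ^ n)⁻¹) =O[⊤] (1 : ℕ → ℝ) :=
  isBigO_top_one_of_tendsto ((tendsto_one_sub_mul_pow x hq).inv₀ one_ne_zero)

theorem isBigO_qPoch (x : ℂ) (hq : ‖q‖ < 1) : qPoch x q =O[⊤] (1 : ℕ → ℝ) :=
  isBigO_top_one_of_tendsto (tendsto_qPoch x hq)

theorem isBigO_inv_qPoch_mul_pow (hq : ‖q‖ < 1) (hx : ∀ n : ℕ, x * q ^ n ≠ 1) :
    (fun p : ℕ × ℕ => (qPoch (x * q ^ p.1) q p.2)⁻¹) =O[⊤] (1 : ℕ × ℕ → ℝ) := by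
  have hinv : (fun n => (qPoch x q n)⁻¹) =O[⊤] (1 : ℕ → ℝ) :=
    isBigO_top_one_of_tendsto ((tendsto_qPoch x hq).inv₀ (qPochInf_ne_zero hq hx))
  have hquot (p : ℕ × ℕ) :
      (qPoch (x * q ^ p.1) q p.2)⁻¹ = qPoch x q p.1 * (qPoch x q (p.1 + p.2))⁻¹ := by
    rw [qPoch_add, mul_inv, mul_inv_cancel_left₀ (qPoch_ne_zero hx p.1)]
  have hfst : (fun p : ℕ × ℕ => qPoch x q p.1) =O[⊤] (1 : ℕ × ℕ → ℝ) :=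
    (isBigO_qPoch x hq).comp_tendsto tendsto_top
  have hadd : (fun p : ℕ × ℕ => (qPoch x q (p.1 + p.2))⁻¹) =O[⊤] (1 : ℕ × ℕ → ℝ) :=
    hinv.comp_tendsto (k := fun p : ℕ × ℕ => p.1 + p.2) tendsto_top
  simpa only [hquot, Pi.one_def, mul_one] using hfst.mul hadd

end QPoch

section Lambert

/-- The summand `x q ^ (n + 1) / (1 - x q ^ (n + 1))` of the Lambert series `lambertSeries x q`. -/
noncomputable def lambertTerm (x q : ℂ) (n : ℕ) : ℂ :=
  x * q ^ (n + 1) / (1 - x * q ^ (n + 1))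

/-- The Lambert series `∑ x q ^ n / (1 - x q ^ n)` over `n ≥ 1`, which is `-x d/dx log (x q; q)_∞`.
It is the building block of both the very-well-poised series and the logarithmic derivative of the
theta function. -/
noncomputable def lambertSeries (x q : ℂ) : ℂ := ∑' n, lambertTerm x q n

variable {x q : ℂ}

theorem lambertTerm_mul_pow (N n : ℕ) :
    lambertTerm (x * q ^ N) q n = lambertTerm x q (N + n) := by
  simp only [lambertTerm, mul_assoc, ← pow_add, add_assoc]

theorem summable_lambertTerm (x : ℂ) (hq : ‖q‖ < 1) : Summable (lambertTerm x q) := by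
  have hgeom := (summable_pow_succ_of_norm_lt_one hq).mul_left x
  have hinv : (fun n : ℕ => (1 - x * q ^ (n + 1))⁻¹) =O[⊤] (1 : ℕ → ℝ) :=
    (isBigO_inv_one_sub_mul_pow x hq).comp_tendsto tendsto_top
  refine summable_of_isBigO_nat hgeom.norm ?_
  exact (((isBigO_refl (fun n : ℕ => x * q ^ (n + 1)) ⊤).norm_right.mul hinv).mono le_top).congr
    (fun n => (div_eq_mul_inv _ _).symm) fun n => mul_one _

end Lambert

section WellPoised

/-- The factor `(z, k / a; q)_n / (q k / z, q a; q)_n (q a / z) ^ n` common to the summand of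
`f(a, k, z, q)` and to its telescoping certificate. -/
noncomputable def vwpWeight (a k z q : ℂ) (n : ℕ) : ℂ :=
  qPoch z q n * qPoch (k / a) q n / (qPoch (k / z * q) q n * qPoch (a * q) q n) * (a / z * q) ^ n

/-- The summand of `f(a, k, z, q)` after cancelling the square roots of `k`. -/
noncomputable def vwpTerm (a k z q : ℂ) (n : ℕ) : ℂ :=
  (1 - k * q ^ n * q ^ n) / ((1 - k * q ^ n) * (1 - q ^ n)) * vwpWeight a k z q n

/-- The Wilf–Zeilberger certificate of `vwpTerm` for the shift `(a, k) ↦ (a q, k q)`. -/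
noncomputable def vwpCert (a k z q : ℂ) (n : ℕ) : ℂ :=
  (1 - k * q ^ n * (a / z * q)) / ((1 - a / z * q) * (1 - k * q ^ n)) * vwpWeight a k z q n

variable {a k z q : ℂ}

theorem complexSqrt_mul_self (k : ℂ) : Complex.sqrt k * Complex.sqrt k = k := by
  rw [← pow_two]
  simp [Complex.sqrt]

theorem fTerm_eq_vwpTerm (hk : ∀ n : ℕ, k * q ^ n ≠ 1) (n : ℕ) :
    fTerm a k z q n = vwpTerm a k z q n := by
  obtain ⟨s, rfl, hs⟩ : ∃ s, k = s * s ∧ Complex.sqrt k = s :=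
    ⟨_, (complexSqrt_mul_self k).symm, rfl⟩
  have hs_ne (n : ℕ) : s * q ^ n ≠ 1 := fun h => hk (n + n) <| by
    rw [pow_add]; linear_combination (s * q ^ n + 1) * h
  have hneg_ne (n : ℕ) : -s * q ^ n ≠ 1 := fun h => hk (n + n) <| by
    rw [pow_add]; linear_combination (-s * q ^ n + 1) * h
  have qPoch_shift {x : ℂ} (hx : ∀ n : ℕ, x * q ^ n ≠ 1) :
      qPoch (x * q) q n = qPoch x q n * (1 - x * q ^ n) / (1 - x) := by
    rw [← one_sub_mul_qPoch_mul, mul_div_cancel_left₀]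
    simpa [sub_ne_zero] using (hx 0).symm
  have one_sub_ne {x : ℂ} (hx : ∀ n : ℕ, x * q ^ n ≠ 1) : 1 - x ≠ 0 := by
    simpa [sub_ne_zero] using (hx 0).symm
  have h₂ := one_sub_ne hs_ne
  have h₃ := one_sub_ne hneg_ne
  have h₄ := qPoch_ne_zero hk n
  have h₅ := qPoch_ne_zero hs_ne n
  have h₆ := qPoch_ne_zero hneg_ne n
  have hcancel : qPoch (s * q) q n * qPoch (-s * q) q n * qPoch (s * s) q n /
      (qPoch s q n * qPoch (-s) q n * qPoch (s * s * q) q n) =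
      (1 - s * s * q ^ n * q ^ n) / (1 - s * s * q ^ n) := by
    rw [qPoch_shift hs_ne, qPoch_shift hneg_ne, qPoch_shift hk]
    generalize qPoch (s * s) q n = P at h₄ ⊢
    field_simp
    ring
  rw [vwpTerm, ← div_div, ← hcancel]
  simp only [fTerm, qPochs, hs, List.map_cons, List.map_nil, List.prod_cons, List.prod_nil,
    mul_one, vwpWeight, mul_comm q, neg_mul, mul_div_right_comm _ q, div_eq_mul_inv, mul_inv]
  ring

theorem vwpWeight_succ (n : ℕ) :
    vwpWeight a k z q (n + 1) = vwpWeight a k z q n * ((1 - z * q ^ n) * (1 - k / a * q ^ n) /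
      ((1 - k / z * q * q ^ n) * (1 - a * q * q ^ n)) * (a / z * q)) := by
  simp only [vwpWeight, qPoch_succ, pow_succ, div_eq_mul_inv, mul_inv]
  ring

theorem vwpWeight_mul_pow (hq : q ≠ 0) (N n : ℕ) :
    vwpWeight (a * q ^ N) (k * q ^ N) z q n = qPoch z q n * qPoch (k / a) q n /
      (qPoch (k / z * q * q ^ N) q n * qPoch (a * q * q ^ N) q n) *
        ((a / z * q) * q ^ N) ^ n := by
  have hka : k * q ^ N / (a * q ^ N) = k / a := mul_div_mul_right _ _ (pow_ne_zero N hq)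
  simp only [vwpWeight, hka, mul_div_right_comm _ (q ^ N), mul_right_comm _ (q ^ N) q]

theorem vwpWeight_mul (hq : q ≠ 0) (hkz : k / z * q ≠ 1) (ha : a * q ≠ 1) (n : ℕ) :
    vwpWeight (a * q) (k * q) z q n = vwpWeight a k z q n *
      (q ^ n * ((1 - k / z * q) * (1 - a * q)) /
        ((1 - k / z * q * q ^ n) * (1 - a * q * q ^ n))) := by
  have qPoch_shift {x : ℂ} (hx : x ≠ 1) :
      (qPoch (x * q) q n)⁻¹ = (qPoch x q n)⁻¹ * ((1 - x) / (1 - x * q ^ n)) := by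
    have hx' : 1 - x ≠ 0 := sub_ne_zero.2 hx.symm
    rw [div_eq_mul_inv, mul_left_comm, ← mul_inv, ← one_sub_mul_qPoch_mul, mul_inv,
      mul_inv_cancel_left₀ hx']
  have h := vwpWeight_mul_pow (a := a) (k := k) (z := z) hq 1 n
  rw [pow_one] at h
  rw [h, vwpWeight, div_eq_mul_inv, mul_inv, qPoch_shift hkz, qPoch_shift ha]
  simp only [div_eq_mul_inv, mul_inv, mul_pow]
  ring

theorem vwpTerm_sub_vwpTerm_mul (ha₀ : a ≠ 0) (hz₀ : z ≠ 0) (hq₀ : q ≠ 0) (hq : ‖q‖ < 1)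
    (hk : ∀ n : ℕ, k * q ^ (n + 1) ≠ 1) (hkz : ∀ n : ℕ, k / z * q ^ (n + 1) ≠ 1)
    (ha : ∀ n : ℕ, a * q ^ (n + 1) ≠ 1) (haz : a / z * q ≠ 1) (n : ℕ) :
    vwpTerm a k z q (n + 1) - vwpTerm (a * q) (k * q) z q (n + 1) =
      vwpCert a k z q (n + 1) - vwpCert a k z q (n + 2) := by
  have h₁ : 1 - q ^ (n + 1) ≠ 0 := sub_ne_zero.2 (pow_succ_ne_one_of_norm_lt_one hq n).symm
  have h₂ : 1 - k * q ^ (n + 1) ≠ 0 := sub_ne_zero.2 (hk n).symm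
  have h₃ : 1 - k * (q ^ (n + 1) * q) ≠ 0 := sub_ne_zero.2 (hk (n + 1)).symm
  have h₄ : 1 - k / z * (q ^ (n + 1) * q) ≠ 0 := sub_ne_zero.2 (hkz (n + 1)).symm
  have h₅ : 1 - a * (q ^ (n + 1) * q) ≠ 0 := sub_ne_zero.2 (ha (n + 1)).symm
  have h₆ : 1 - a / z * q ≠ 0 := sub_ne_zero.2 haz.symm
  have hweight_shift := vwpWeight_mul (a := a) (k := k) (z := z) hq₀
    (by simpa using hkz 0) (by simpa using ha 0) (n + 1)
  obtain ⟨α, rfl⟩ : ∃ α, a = z * α := ⟨a / z, (mul_div_cancel₀ a hz₀).symm⟩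
  obtain ⟨κ, rfl⟩ : ∃ κ, k = z * κ := ⟨k / z, (mul_div_cancel₀ k hz₀).symm⟩
  have hα₀ : α ≠ 0 := right_ne_zero_of_mul ha₀
  simp only [mul_div_cancel_left₀ _ hz₀] at h₄ h₆ hweight_shift
  simp only [vwpTerm, vwpCert, show n + 2 = n + 1 + 1 from rfl, hweight_shift,
    vwpWeight_succ (n + 1), pow_succ q (n + 1), mul_div_cancel_left₀ _ hz₀,
    mul_div_mul_left _ _ hz₀]
  generalize vwpWeight (z * α) (z * κ) z q (n + 1) = W
  generalize q ^ (n + 1) = Q at h₁ h₂ h₃ h₄ h₅ ⊢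
  rw [← mul_assoc] at h₃ h₄
  rw [mul_right_comm, ← mul_assoc] at h₅
  rw [mul_comm] at h₆
  field_simp
  ring

theorem vwpCert_one (ha₀ : a ≠ 0) (hz₀ : z ≠ 0) (hk : k * q ≠ 1) (hkz : k / z * q ≠ 1)
    (ha : a * q ≠ 1) (haz : a / z * q ≠ 1) :
    vwpCert a k z q 1 = lambertTerm k q 0 + lambertTerm (a / z) q 0 - lambertTerm (k / z) q 0 -
      lambertTerm a q 0 := by
  have h₁ : 1 - k * q ≠ 0 := sub_ne_zero.2 hk.symm
  have h₂ : 1 - k / z * q ≠ 0 := sub_ne_zero.2 hkz.symm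
  have h₃ : 1 - a * q ≠ 0 := sub_ne_zero.2 ha.symm
  have h₄ : 1 - a / z * q ≠ 0 := sub_ne_zero.2 haz.symm
  obtain ⟨α, rfl⟩ : ∃ α, a = z * α := ⟨a / z, (mul_div_cancel₀ a hz₀).symm⟩
  obtain ⟨κ, rfl⟩ : ∃ κ, k = z * κ := ⟨k / z, (mul_div_cancel₀ k hz₀).symm⟩
  have hα₀ : α ≠ 0 := right_ne_zero_of_mul ha₀
  rw [mul_div_cancel_left₀ _ hz₀] at h₂
  rw [mul_right_comm] at h₃
  rw [mul_div_cancel_left₀ _ hz₀, mul_comm] at h₄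
  simp only [vwpCert, vwpWeight, lambertTerm, qPoch_succ, qPoch_zero, pow_one, pow_zero, one_mul,
    zero_add, mul_one, mul_div_cancel_left₀ _ hz₀, mul_div_mul_left _ _ hz₀]
  field_simp
  ring

theorem isBigO_vwpWeight_shift (hq₀ : q ≠ 0) (hq : ‖q‖ < 1)
    (hkz : ∀ n : ℕ, k / z * q ^ (n + 1) ≠ 1) (ha : ∀ n : ℕ, a * q ^ (n + 1) ≠ 1) :
    (fun p : ℕ × ℕ => vwpWeight (a * q ^ p.1) (k * q ^ p.1) z q p.2) =O[⊤]
      fun p => (a / z * q * q ^ p.1) ^ p.2 := by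
  have hnum (x : ℂ) : (fun p : ℕ × ℕ => qPoch x q p.2) =O[⊤] (1 : ℕ × ℕ → ℝ) :=
    (isBigO_qPoch x hq).comp_tendsto tendsto_top
  have hden {x : ℂ} (hx : ∀ n : ℕ, x * q ^ (n + 1) ≠ 1) :
      (fun p : ℕ × ℕ => (qPoch (x * q * q ^ p.1) q p.2)⁻¹) =O[⊤] (1 : ℕ × ℕ → ℝ) :=
    isBigO_inv_qPoch_mul_pow hq fun n => by simpa only [mul_assoc, ← pow_succ'] using hx n
  have hpow := isBigO_refl (fun p : ℕ × ℕ => (a / z * q * q ^ p.1) ^ p.2) ⊤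
  exact ((((hnum z).mul (hnum (k / a))).mul ((hden hkz).mul (hden ha))).mul hpow.norm_right).congr
    (fun p => by rw [vwpWeight_mul_pow hq₀, div_eq_mul_inv _ (_ * _), mul_inv]) (fun p => by simp)
    |>.of_norm_right

theorem isBigO_vwpTerm_shift (hq₀ : q ≠ 0) (hq : ‖q‖ < 1)
    (hkz : ∀ n : ℕ, k / z * q ^ (n + 1) ≠ 1) (ha : ∀ n : ℕ, a * q ^ (n + 1) ≠ 1) :
    (fun p : ℕ × ℕ => vwpTerm (a * q ^ p.1) (k * q ^ p.1) z q (p.2 + 1)) =O[⊤]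
      fun p => q ^ p.1 * (a / z * q) ^ (p.2 + 1) := by
  have hcoeff (m : ℕ × ℕ → ℕ) : (fun p => 1 - k * q ^ m p) =O[⊤] (1 : ℕ × ℕ → ℝ) :=
    (isBigO_top_one_of_tendsto (tendsto_one_sub_mul_pow k hq)).comp_tendsto tendsto_top
  have hinv (x : ℂ) (m : ℕ × ℕ → ℕ) : (fun p => (1 - x * q ^ m p)⁻¹) =O[⊤] (1 : ℕ × ℕ → ℝ) :=
    (isBigO_inv_one_sub_mul_pow x hq).comp_tendsto tendsto_top
  have hweight := (isBigO_vwpWeight_shift hq₀ hq hkz ha).comp_tendsto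
    (tendsto_top (l := (⊤ : Filter (ℕ × ℕ))) (f := fun p => (p.1, p.2 + 1)))
  have hfactor := (hcoeff fun p => p.1 + (p.2 + 1) + (p.2 + 1)).mul
    ((hinv k fun p => p.1 + (p.2 + 1)).mul (hinv 1 fun p => p.2 + 1))
  have hpow : (fun p : ℕ × ℕ => (a / z * q * q ^ p.1) ^ (p.2 + 1)) =O[⊤]
      fun p => q ^ p.1 * (a / z * q) ^ (p.2 + 1) := by
    refine .of_bound' (.of_forall fun p => ?_)
    rw [mul_pow, norm_mul, norm_mul, mul_comm, ← pow_mul, norm_pow q, norm_pow q]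
    gcongr ?_ * _
    exact pow_le_pow_of_le_one (norm_nonneg q) hq.le (Nat.le_mul_of_pos_right _ p.2.succ_pos)
  suffices hterm : (fun p : ℕ × ℕ => vwpTerm (a * q ^ p.1) (k * q ^ p.1) z q (p.2 + 1)) =O[⊤]
      fun p : ℕ × ℕ => ‖(a / z * q * q ^ p.1) ^ (p.2 + 1)‖ from
    hterm.of_norm_right.trans hpow
  refine (hfactor.mul hweight.norm_right).congr (fun p => ?_) fun p => ?_
  · simp only [Function.comp, vwpTerm, div_eq_mul_inv, mul_inv, pow_add, mul_assoc, one_mul]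
  · simp

theorem tendsto_sum_range_of_wz_pair {E : Type*} [AddCommGroup E] [TopologicalSpace E]
    [IsTopologicalAddGroup E] [T2Space E] {F G : ℕ → ℕ → E}
    (hFG : ∀ N n, F N n - F (N + 1) n = G N n - G N (n + 1)) (hF : ∀ N, Summable (F N))
    (hF₀ : Tendsto (fun N => ∑' n, F N n) atTop (𝓝 0))
    (hG₀ : ∀ N, Tendsto (G N) atTop (𝓝 0)) :
    Tendsto (fun M => ∑ N ∈ Finset.range M, G N 0) atTop (𝓝 (∑' n, F 0 n)) := by
  have hrow (N : ℕ) : ∑' n, F N n - ∑' n, F (N + 1) n = G N 0 := by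
    rw [← (hF N).tsum_sub (hF (N + 1))]
    refine tendsto_nhds_unique ((hF N).sub (hF (N + 1))).hasSum.tendsto_sum_nat ?_
    simpa only [hFG, Finset.sum_range_sub', sub_zero] using (hG₀ N).const_sub (G N 0)
  simpa only [← hrow, Finset.sum_range_sub', sub_zero] using hF₀.const_sub (∑' n, F 0 n)

theorem tendsto_vwpCert (hq : ‖q‖ < 1) (hkz : ∀ n : ℕ, k / z * q ^ (n + 1) ≠ 1)
    (ha : ∀ n : ℕ, a * q ^ (n + 1) ≠ 1) (haz : ‖a / z * q‖ < 1) :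
    Tendsto (vwpCert a k z q) atTop (𝓝 0) := by
  have hden {x : ℂ} (hx : ∀ n : ℕ, x * q ^ (n + 1) ≠ 1) : qPochInf (x * q) q ≠ 0 :=
    qPochInf_ne_zero hq fun n => by simpa only [mul_assoc, ← pow_succ'] using hx n
  have hweight : Tendsto (vwpWeight a k z q) atTop (𝓝 (_ * 0)) :=
    (((tendsto_qPoch z hq).mul (tendsto_qPoch (k / a) hq)).div
      ((tendsto_qPoch (k / z * q) hq).mul (tendsto_qPoch (a * q) hq))
      (mul_ne_zero (hden hkz) (hden ha))).mul (tendsto_pow_atTop_nhds_zero_of_norm_lt_one haz)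
  have hnum : Tendsto (fun n => 1 - k * q ^ n * (a / z * q)) atTop (𝓝 1) := by
    simpa only [mul_right_comm k] using tendsto_one_sub_mul_pow (k * (a / z * q)) hq
  have hcoeff := hnum.div ((tendsto_one_sub_mul_pow k hq).const_mul (1 - a / z * q)) <| by
    simpa only [mul_one] using sub_ne_zero.2 fun h => by simp [← h] at haz
  rw [mul_zero] at hweight
  exact mul_zero (_ : ℂ) ▸ hcoeff.mul hweight

theorem summable_vwpTerm (hq₀ : q ≠ 0) (hq : ‖q‖ < 1)
    (hkz : ∀ n : ℕ, k / z * q ^ (n + 1) ≠ 1) (ha : ∀ n : ℕ, a * q ^ (n + 1) ≠ 1)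
    (haz : ‖a / z * q‖ < 1) : Summable fun n => vwpTerm a k z q (n + 1) := by
  have hgeom := (summable_pow_succ_of_norm_lt_one haz).norm
  refine summable_of_isBigO_nat hgeom (IsBigO.norm_right ?_)
  simpa [Function.comp_def] using ((isBigO_vwpTerm_shift hq₀ hq hkz ha).comp_tendsto
    (tendsto_top (l := ⊤) (f := fun n : ℕ => (0, n)))).mono le_top

theorem tendsto_tsum_vwpTerm_shift (hq₀ : q ≠ 0) (hq : ‖q‖ < 1)
    (hkz : ∀ n : ℕ, k / z * q ^ (n + 1) ≠ 1) (ha : ∀ n : ℕ, a * q ^ (n + 1) ≠ 1)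
    (haz : ‖a / z * q‖ < 1) :
    Tendsto (fun N => ∑' n, vwpTerm (a * q ^ N) (k * q ^ N) z q (n + 1)) atTop (𝓝 0) := by
  have hgeom := (summable_pow_succ_of_norm_lt_one haz).norm
  obtain ⟨C, hC⟩ := isBigO_top.1 (isBigO_vwpTerm_shift hq₀ hq hkz ha)
  have hbound (N : ℕ) : ‖∑' n, vwpTerm (a * q ^ N) (k * q ^ N) z q (n + 1)‖ ≤
      C * ‖q‖ ^ N * ∑' n, ‖(a / z * q) ^ (n + 1)‖ := by
    rw [← tsum_mul_left]
    refine tsum_of_norm_bounded (hgeom.mul_left _).hasSum fun n => ?_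
    simpa only [norm_mul, norm_pow, mul_assoc] using hC (N, n)
  refine squeeze_zero_norm hbound ?_
  simpa only [mul_zero, zero_mul] using ((tendsto_pow_atTop_nhds_zero_of_lt_one
    (norm_nonneg q) hq).const_mul C).mul_const (∑' n, ‖(a / z * q) ^ (n + 1)‖)

theorem hasSum_vwpTerm (ha₀ : a ≠ 0) (hz₀ : z ≠ 0) (hq₀ : q ≠ 0) (hq : ‖q‖ < 1)
    (hk : ∀ n : ℕ, k * q ^ (n + 1) ≠ 1) (hkz : ∀ n : ℕ, k / z * q ^ (n + 1) ≠ 1)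
    (ha : ∀ n : ℕ, a * q ^ (n + 1) ≠ 1) (haz : ‖a / z * q‖ < 1) :
    HasSum (fun n => vwpTerm a k z q (n + 1))
      (lambertSeries k q + lambertSeries (a / z) q - lambertSeries (k / z) q -
        lambertSeries a q) := by
  have hdiv (x : ℂ) (N : ℕ) : x * q ^ N / z = x / z * q ^ N := mul_div_right_comm _ _ _
  have ha₀N (N : ℕ) : a * q ^ N ≠ 0 := mul_ne_zero ha₀ (pow_ne_zero N hq₀)
  have hkN := mul_pow_mul_pow_succ_ne_one hk
  have haN := mul_pow_mul_pow_succ_ne_one ha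
  have hkzN (N n : ℕ) : k * q ^ N / z * q ^ (n + 1) ≠ 1 :=
    hdiv k N ▸ mul_pow_mul_pow_succ_ne_one hkz N n
  have hazN (N : ℕ) : ‖a * q ^ N / z * q‖ < 1 := hdiv a N ▸ norm_mul_pow_mul_lt_one hq haz N
  have hazN_ne (N : ℕ) : a * q ^ N / z * q ≠ 1 := fun h => by simpa [h] using hazN N
  have hsum := tendsto_sum_range_of_wz_pair
    (F := fun N n => vwpTerm (a * q ^ N) (k * q ^ N) z q (n + 1))
    (G := fun N n => vwpCert (a * q ^ N) (k * q ^ N) z q (n + 1))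
    (fun N n => by
      simpa only [mul_assoc, ← pow_succ] using vwpTerm_sub_vwpTerm_mul
        (ha₀N N) hz₀ hq₀ hq (hkN N) (hkzN N) (haN N) (hazN_ne N) n)
    (fun N => summable_vwpTerm hq₀ hq (hkzN N) (haN N) (hazN N))
    (tendsto_tsum_vwpTerm_shift hq₀ hq hkz ha haz)
    (fun N => (tendsto_add_atTop_iff_nat 1).2 (tendsto_vwpCert hq (hkzN N) (haN N) (hazN N)))
  have hcert (N : ℕ) : vwpCert (a * q ^ N) (k * q ^ N) z q 1 = lambertTerm k q N +
      lambertTerm (a / z) q N - lambertTerm (k / z) q N - lambertTerm a q N := by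
    rw [vwpCert_one (ha₀N N) hz₀ (by simpa using hkN N 0) (by simpa using hkzN N 0)
      (by simpa using haN N 0) (hazN_ne N)]
    simp only [hdiv, lambertTerm_mul_pow, add_zero]
  have hlambert := (((summable_lambertTerm k hq).hasSum.add
    (summable_lambertTerm (a / z) hq).hasSum).sub (summable_lambertTerm (k / z) hq).hasSum).sub
      (summable_lambertTerm a hq).hasSum
  convert (summable_vwpTerm hq₀ hq hkz ha haz).hasSum using 1
  refine tendsto_nhds_unique hlambert.tendsto_sum_nat ?_
  simpa only [hcert, zero_add, pow_zero, mul_one] using hsum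

end WellPoised

section Theta

/-- The theta function `θ(x) = (x, q / x; q)_∞` of base `q`. -/
noncomputable def qTheta (x q : ℂ) : ℂ := qPochInf x q * qPochInf (q / x) q

/-- The summand of the bilateral theta series `thetaSeries x q`. -/
noncomputable def thetaTerm (x q : ℂ) (m : ℤ) : ℂ := (-1) ^ m * q ^ (m * (m - 1) / 2) * x ^ m

/-- The theta series `∑ (-1) ^ m q ^ (m (m - 1) / 2) x ^ m` over `m ∈ ℤ`, equal to
`(q; q)_∞ θ(x)` by the Jacobi triple product. -/
noncomputable def thetaSeries (x q : ℂ) : ℂ := ∑' m, thetaTerm x q m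

/-- The summand of `squareThetaSeries x q`. -/
noncomputable def squareThetaTerm (x q : ℂ) (m : ℤ) : ℂ := q ^ (m * m) * x ^ m

/-- The theta series `∑ q ^ (m ^ 2) x ^ m` over `m ∈ ℤ`, of base `q ^ 2`, into which products of two
theta series of base `q` decompose. -/
noncomputable def squareThetaSeries (x q : ℂ) : ℂ := ∑' m, squareThetaTerm x q m

/-- The tail `(q ^ (n + 1); q)_∞`, that is `(q; q)_∞ / (q; q)_n`. It vanishes for `n < 0`, which
turns the finite sums in the proof of the triple product into sums over all of `ℤ`. -/
noncomputable def qPochTail (q : ℂ) (n : ℤ) : ℂ := qPochInf (q ^ (n + 1)) q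

variable {x y q : ℂ}

theorem triangle_add_one (m : ℤ) : (m + 1) * (m + 1 - 1) / 2 = m * (m - 1) / 2 + m := by
  rw [← Int.add_mul_ediv_right _ _ two_ne_zero]
  ring_nf

theorem thetaTerm_add_one (hx₀ : x ≠ 0) (hq₀ : q ≠ 0) (m : ℤ) :
    thetaTerm x q (m + 1) = -(x * q ^ m) * thetaTerm x q m := by
  rw [thetaTerm, thetaTerm, triangle_add_one, zpow_add₀ hq₀, zpow_add_one₀ hx₀,
    zpow_add_one₀ (by norm_num)]
  ring

theorem thetaTerm_neg (hq₀ : q ≠ 0) (m : ℤ) : thetaTerm x q (-m) = thetaTerm (q / x) q m := by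
  have hexp : -m * (-m - 1) / 2 = m * (m - 1) / 2 + m := by
    rw [← triangle_add_one]
    ring_nf
  rw [thetaTerm, thetaTerm, hexp, zpow_add₀ hq₀, div_zpow, zpow_neg x, zpow_neg, ← inv_zpow,
    inv_neg, inv_one]
  ring

theorem thetaTerm_ne_zero (hx₀ : x ≠ 0) (hq₀ : q ≠ 0) (m : ℤ) : thetaTerm x q m ≠ 0 :=
  mul_ne_zero (mul_ne_zero (zpow_ne_zero _ (by norm_num)) (zpow_ne_zero _ hq₀)) (zpow_ne_zero _ hx₀)

theorem summable_thetaTerm_natCast (hx₀ : x ≠ 0) (hq₀ : q ≠ 0) (hq : ‖q‖ < 1) :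
    Summable fun n : ℕ => thetaTerm x q n := by
  refine summable_of_ratio_test_tendsto_lt_one one_pos
    (.of_forall fun n => by simpa using thetaTerm_ne_zero hx₀ hq₀ n) ?_
  have hratio (n : ℕ) : ‖thetaTerm x q (n + 1 : ℕ)‖ / ‖thetaTerm x q n‖ = ‖x‖ * ‖q‖ ^ n := by
    rw [Nat.cast_succ, thetaTerm_add_one hx₀ hq₀, norm_mul, norm_neg, norm_mul, zpow_natCast,
      norm_pow, mul_div_cancel_right₀ _ (norm_ne_zero_iff.2 (thetaTerm_ne_zero hx₀ hq₀ n))]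
  simpa only [hratio, mul_zero] using
    (tendsto_pow_atTop_nhds_zero_of_lt_one (norm_nonneg q) hq).const_mul ‖x‖

theorem summable_thetaTerm (hx₀ : x ≠ 0) (hq₀ : q ≠ 0) (hq : ‖q‖ < 1) :
    Summable (thetaTerm x q) :=
  .of_nat_of_neg (summable_thetaTerm_natCast hx₀ hq₀ hq) <| by
    simpa only [thetaTerm_neg hq₀] using summable_thetaTerm_natCast (div_ne_zero hq₀ hx₀) hq₀ hq

theorem qPochTail_eq_one_sub_mul (hq₀ : q ≠ 0) (hq : ‖q‖ < 1) (n : ℤ) :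
    qPochTail q n = (1 - q ^ (n + 1)) * qPochTail q (n + 1) := by
  rw [qPochTail, qPochInf_eq_one_sub_mul _ hq, ← zpow_add_one₀ hq₀, qPochTail]

theorem qPochTail_eq_zero (hq₀ : q ≠ 0) {n : ℤ} (hn : n < 0) : qPochTail q n = 0 := by
  obtain ⟨j, hj⟩ := Int.eq_ofNat_of_zero_le (a := -(n + 1)) (by omega)
  refine qPochInf_eq_zero (n := j) ?_
  rw [← zpow_natCast, ← zpow_add₀ hq₀, ← hj, add_neg_cancel, zpow_zero]

theorem exists_norm_qPochTail_le (hq₀ : q ≠ 0) (hq : ‖q‖ < 1) : ∃ C, ∀ n, ‖qPochTail q n‖ ≤ C := by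
  obtain ⟨C, hC⟩ := (isCompact_closedBall (0 : ℂ) 1).exists_bound_of_continuousOn
    (differentiable_qPochInf hq).continuous.continuousOn
  refine ⟨C, fun n => ?_⟩
  rcases lt_or_ge n 0 with hn | hn
  · rw [qPochTail_eq_zero hq₀ hn, norm_zero]
    exact (norm_nonneg _).trans (hC 0 (by simp))
  · lift n to ℕ using hn
    refine hC _ (mem_closedBall_zero_iff.2 ?_)
    exact_mod_cast (norm_pow q (n + 1)).trans_le (pow_le_one₀ (norm_nonneg q) hq.le)

theorem tendsto_qPochTail (hq₀ : q ≠ 0) (hq : ‖q‖ < 1) (m : ℤ) :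
    Tendsto (fun N : ℕ => qPochTail q (N + m)) atTop (𝓝 1) := by
  have hpow : Tendsto (fun N : ℕ => q ^ (N + m + 1 : ℤ)) atTop (𝓝 0) := by
    simpa only [add_assoc, zpow_add₀ hq₀ (_ : ℕ), zpow_natCast, zero_mul] using
      (tendsto_pow_atTop_nhds_zero_of_norm_lt_one hq).mul_const (q ^ (m + 1))
  rw [← qPochInf_zero_left (q := q)]
  exact ((differentiable_qPochInf hq).continuous.tendsto 0).comp hpow

/-- This is the recurrence in `N` that produces the factors `1 - x q ^ N` and `1 - q ^ (N + 1) / x`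
of the triple product. -/
theorem qPochTail_mul_thetaTerm_succ (hx₀ : x ≠ 0) (hq₀ : q ≠ 0) (hq : ‖q‖ < 1) (N m : ℤ) :
    (1 - q ^ (2 * N + 1)) * (1 - q ^ (2 * N + 1 + 1)) *
        (qPochTail q (N + 1 + m) * qPochTail q (N + 1 - m) * thetaTerm x q m) =
      (1 + q ^ (2 * N + 1)) * (qPochTail q (N + m) * qPochTail q (N - m) * thetaTerm x q m) -
        x * q ^ N * (qPochTail q (N + (m - 1)) * qPochTail q (N - (m - 1)) *
          thetaTerm x q (m - 1)) -
        q ^ (N + 1) / x * (qPochTail q (N + (m + 1)) * qPochTail q (N - (m + 1)) *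
          thetaTerm x q (m + 1)) := by
  obtain ⟨l, rfl⟩ : ∃ l, m = l + 1 := ⟨m - 1, by ring⟩
  have h₁ := qPochTail_eq_one_sub_mul hq₀ hq (N + (l + 1))
  have h₂ := qPochTail_eq_one_sub_mul hq₀ hq (N + l)
  have h₃ := qPochTail_eq_one_sub_mul hq₀ hq (N - (l + 1))
  have h₄ := qPochTail_eq_one_sub_mul hq₀ hq (N - (l + 1 + 1))
  rw [show N - (l + 1 + 1) + 1 = N - (l + 1) by ring] at h₄
  rw [show N + l + 1 = N + (l + 1) by ring] at h₂
  rw [show N + (l + 1) + 1 = N + 1 + (l + 1) by ring] at h₁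
  rw [show N - (l + 1) + 1 = N - l by ring] at h₃
  rw [add_sub_cancel_right, show N + 1 - (l + 1) = N - l by ring,
    show N + (l + 1 + 1) = N + 1 + (l + 1) by ring, h₂, h₁, h₄, h₃,
    thetaTerm_add_one hx₀ hq₀ (l + 1), thetaTerm_add_one hx₀ hq₀ l]
  simp only [zpow_add₀ hq₀, zpow_sub₀ hq₀, two_mul, zpow_one]
  have hl := zpow_ne_zero l hq₀
  field_simp
  ring

theorem hasSum_qPochTail_mul_thetaTerm (hx₀ : x ≠ 0) (hq₀ : q ≠ 0) (hq : ‖q‖ < 1) (N : ℕ) :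
    HasSum (fun m : ℤ => qPochTail q (N + m) * qPochTail q (N - m) * thetaTerm x q m)
      (qPochTail q 0 * qPochTail q (2 * N) * (qPoch x q N * qPoch (q / x) q N)) := by
  induction N with
  | zero =>
    convert hasSum_single (0 : ℤ) fun m hm => ?_ using 1
    · simp [thetaTerm]
    · rcases hm.lt_or_gt with h | h
      · rw [qPochTail_eq_zero hq₀ (by simpa using h), zero_mul, zero_mul]
      · rw [qPochTail_eq_zero hq₀ (n := _ - m) (by simpa using h), mul_zero, zero_mul]
  | succ N ih =>
    have one_sub_ne (n : ℕ) : 1 - q ^ ((n : ℤ) + 1) ≠ 0 :=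
      sub_ne_zero.2 (by exact_mod_cast (pow_succ_ne_one_of_norm_lt_one hq n).symm)
    have h₁ : 1 - q ^ (2 * (N : ℤ) + 1) ≠ 0 := by exact_mod_cast one_sub_ne (2 * N)
    have h₂ : 1 - q ^ (2 * (N : ℤ) + 1 + 1) ≠ 0 := by exact_mod_cast one_sub_ne (2 * N + 1)
    have hstep := ((ih.mul_left (1 + q ^ (2 * (N : ℤ) + 1))).sub
      (((Equiv.subRight (1 : ℤ)).hasSum_iff.2 ih).mul_left (x * q ^ (N : ℤ)))).sub
      (((Equiv.addRight (1 : ℤ)).hasSum_iff.2 ih).mul_left (q ^ ((N : ℤ) + 1) / x))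
    simp only [Function.comp_def, Equiv.subRight_apply, Equiv.coe_addRight,
      ← qPochTail_mul_thetaTerm_succ hx₀ hq₀ hq] at hstep
    rw [← hasSum_mul_left_iff (mul_ne_zero h₁ h₂), Nat.cast_add_one]
    refine (congrArg (HasSum _) ?_).mp hstep
    rw [qPochTail_eq_one_sub_mul hq₀ hq (2 * N), qPochTail_eq_one_sub_mul hq₀ hq (2 * N + 1),
      qPoch_succ, qPoch_succ, show 2 * ((N : ℤ) + 1) = 2 * N + 1 + 1 by ring]
    simp only [zpow_add₀ hq₀, two_mul, zpow_one, zpow_natCast]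
    field_simp
    ring

theorem thetaSeries_eq_qPochInf_mul_qTheta (hx₀ : x ≠ 0) (hq₀ : q ≠ 0) (hq : ‖q‖ < 1) :
    thetaSeries x q = qPochInf q q * qTheta x q := by
  obtain ⟨C, hC⟩ := exists_norm_qPochTail_le hq₀ hq
  have hC₀ : 0 ≤ C := (norm_nonneg _).trans (hC 0)
  have htail (m : ℤ) : Tendsto (fun N : ℕ => qPochTail q (N + m) * qPochTail q (N - m) *
      thetaTerm x q m) atTop (𝓝 (thetaTerm x q m)) := by
    simpa only [sub_eq_add_neg, one_mul] using ((tendsto_qPochTail hq₀ hq m).mul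
      (tendsto_qPochTail hq₀ hq (-m))).mul_const (thetaTerm x q m)
  have hbound (N : ℕ) (m : ℤ) :
      ‖qPochTail q (N + m) * qPochTail q (N - m) * thetaTerm x q m‖ ≤
        C * C * ‖thetaTerm x q m‖ := by
    rw [norm_mul, norm_mul]
    gcongr <;> exact hC _
  have hleft : Tendsto (fun N : ℕ => ∑' m : ℤ, qPochTail q (N + m) * qPochTail q (N - m) *
      thetaTerm x q m) atTop (𝓝 (thetaSeries x q)) :=
    tendsto_tsum_of_dominated_convergence ((summable_thetaTerm hx₀ hq₀ hq).norm.mul_left (C * C))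
      htail (.of_forall hbound)
  have htwo : Tendsto (fun N : ℕ => qPochTail q (2 * N)) atTop (𝓝 1) := by
    simpa [Function.comp_def] using
      (tendsto_qPochTail hq₀ hq 0).comp (tendsto_id.const_mul_atTop' two_pos)
  have hright := (htwo.const_mul (qPochTail q 0)).mul
    ((tendsto_qPoch x hq).mul (tendsto_qPoch (q / x) hq))
  simp only [(hasSum_qPochTail_mul_thetaTerm hx₀ hq₀ hq _).tsum_eq] at hleft
  simpa [qPochTail, qTheta] using tendsto_nhds_unique hleft hright

/-- The bijection of two copies of `ℤ × ℤ` onto `ℤ × ℤ` whose restrictions have as images the pairs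
with even and with odd sum. -/
def parityMap : (ℤ × ℤ) ⊕ (ℤ × ℤ) → ℤ × ℤ :=
  Sum.elim (fun p => (p.1 + 1 + p.2, p.1 + 1 - p.2)) fun p => (p.1 + p.2 + 1, p.1 - p.2)

theorem parityMap_bijective : Function.Bijective parityMap := by
  constructor
  · rintro (⟨i, j⟩ | ⟨i, j⟩) (⟨i', j'⟩ | ⟨i', j'⟩) h <;>
      simp only [parityMap, Sum.elim_inl, Sum.elim_inr, Prod.mk.injEq] at h <;>
      first
        | (exfalso; omega)
        | (congr 2 <;> omega)
  · rintro ⟨m, n⟩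
    rcases Int.even_or_odd' (m + n) with ⟨c, h | h⟩
    · refine ⟨Sum.inl (c - 1, m - c), ?_⟩
      simp only [parityMap, Sum.elim_inl, Prod.mk.injEq]
      omega
    · refine ⟨Sum.inr (c, m - c - 1), ?_⟩
      simp only [parityMap, Sum.elim_inr, Prod.mk.injEq]
      omega

theorem squareThetaTerm_eq_thetaTerm (hq₀ : q ≠ 0) (x : ℂ) (m : ℤ) :
    squareThetaTerm x q m = thetaTerm (-(q * x)) (q ^ 2) m := by
  have htwice : 2 * (m * (m - 1) / 2) = m * m - m := by
    rw [Int.mul_ediv_cancel' (Int.even_mul_pred_self m).two_dvd]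
    ring
  have hpow : (q ^ 2) ^ (m * (m - 1) / 2) = q ^ (m * m - m) := by
    rw [← htwice, zpow_mul, zpow_ofNat]
  have hsign : (-1 : ℂ) ^ m * (-1) ^ m = 1 := by rw [← mul_zpow]; simp
  have hqm := zpow_ne_zero m hq₀
  rw [squareThetaTerm, thetaTerm, hpow, neg_eq_neg_one_mul (q * x), mul_zpow, mul_zpow,
    zpow_sub₀ hq₀]
  field_simp
  linear_combination -(x ^ m) * hsign

theorem summable_squareThetaTerm (hx₀ : x ≠ 0) (hq₀ : q ≠ 0) (hq : ‖q‖ < 1) :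
    Summable (squareThetaTerm x q) := by
  have hq2 : ‖q ^ 2‖ < 1 := by
    simpa only [norm_pow] using pow_lt_one₀ (norm_nonneg q) hq two_ne_zero
  exact (summable_thetaTerm (neg_ne_zero.2 (mul_ne_zero hq₀ hx₀)) (pow_ne_zero 2 hq₀) hq2).congr
    fun m => (squareThetaTerm_eq_thetaTerm hq₀ x m).symm

theorem thetaTerm_mul_thetaTerm (hq₀ : q ≠ 0) (m n : ℤ) :
    thetaTerm x q m * thetaTerm y q n =
      (-1) ^ (m + n) * q ^ ((m * (m - 1) + n * (n - 1)) / 2) * (x ^ m * y ^ n) := by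
  rw [Int.add_ediv_of_dvd_left (Int.even_mul_pred_self m).two_dvd, zpow_add₀ hq₀,
    zpow_add₀ (by norm_num), thetaTerm, thetaTerm]
  ring

theorem thetaTerm_mul_thetaTerm_of_even (hx₀ : x ≠ 0) (hy₀ : y ≠ 0) (hq₀ : q ≠ 0) (i j : ℤ) :
    thetaTerm x q (i + 1 + j) * thetaTerm y q (i + 1 - j) =
      x * y * (squareThetaTerm (q * (x * y)) q i * squareThetaTerm (x / y) q j) := by
  rw [thetaTerm_mul_thetaTerm hq₀, Even.neg_one_zpow ⟨i + 1, by ring⟩,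
    Int.ediv_eq_of_eq_mul_left two_ne_zero (c := i * i + i + j * j) (by ring)]
  simp only [squareThetaTerm, zpow_add₀ hq₀, zpow_add₀ hx₀, zpow_add₀ hy₀, zpow_sub₀ hy₀, mul_zpow,
    div_zpow, zpow_one]
  ring

theorem thetaTerm_mul_thetaTerm_of_odd (hx₀ : x ≠ 0) (hy₀ : y ≠ 0) (hq₀ : q ≠ 0) (i j : ℤ) :
    thetaTerm x q (i + j + 1) * thetaTerm y q (i - j) =
      -x * (squareThetaTerm (x * y) q i * squareThetaTerm (q * (x / y)) q j) := by
  rw [thetaTerm_mul_thetaTerm hq₀, Odd.neg_one_zpow ⟨i, by ring⟩,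
    Int.ediv_eq_of_eq_mul_left two_ne_zero (c := i * i + j * j + j) (by ring)]
  simp only [squareThetaTerm, zpow_add₀ hq₀, zpow_add₀ hx₀, zpow_sub₀ hy₀, mul_zpow, div_zpow,
    zpow_one]
  ring

theorem thetaSeries_mul_thetaSeries (hx₀ : x ≠ 0) (hy₀ : y ≠ 0) (hq₀ : q ≠ 0) (hq : ‖q‖ < 1) :
    thetaSeries x q * thetaSeries y q =
      x * (y * (squareThetaSeries (q * (x * y)) q * squareThetaSeries (x / y) q) -
        squareThetaSeries (x * y) q * squareThetaSeries (q * (x / y)) q) := by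
  have hxy := mul_ne_zero hx₀ hy₀
  have hx_div := div_ne_zero hx₀ hy₀
  have hsum {w : ℂ} (hw₀ : w ≠ 0) := (summable_squareThetaTerm hw₀ hq₀ hq).norm
  have heven := (summable_mul_of_summable_norm (hsum (mul_ne_zero hq₀ hxy)) (hsum hx_div)).hasSum
  have hodd := (summable_mul_of_summable_norm (hsum hxy) (hsum (mul_ne_zero hq₀ hx_div))).hasSum
  simp only [thetaSeries, squareThetaSeries]
  rw [tsum_mul_tsum_of_summable_norm (summable_thetaTerm hx₀ hq₀ hq).norm
      (summable_thetaTerm hy₀ hq₀ hq).norm,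
    tsum_mul_tsum_of_summable_norm (hsum (mul_ne_zero hq₀ hxy)) (hsum hx_div),
    tsum_mul_tsum_of_summable_norm (hsum hxy) (hsum (mul_ne_zero hq₀ hx_div)),
    ← (Equiv.ofBijective _ parityMap_bijective).tsum_eq, mul_sub, sub_eq_add_neg, ← neg_mul,
    ← mul_assoc]
  refine HasSum.tsum_eq (HasSum.sum ?_ ?_)
  · simpa only [Function.comp_def, Equiv.ofBijective_apply, parityMap, Sum.elim_inl,
      thetaTerm_mul_thetaTerm_of_even hx₀ hy₀ hq₀] using heven.mul_left (x * y)
  · simpa only [Function.comp_def, Equiv.ofBijective_apply, parityMap, Sum.elim_inr,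
      thetaTerm_mul_thetaTerm_of_odd hx₀ hy₀ hq₀] using hodd.mul_left (-x)

/-- Weierstrass' three-term relation, in variables that avoid square roots: each of the six products
of two theta functions involves only two of `a k t² / z`, `k z / a`, `a z / k`, `a k / z` after the
parity splitting. -/
theorem qTheta_three_term {a k z t : ℂ} (ha₀ : a ≠ 0) (hk₀ : k ≠ 0) (hz₀ : z ≠ 0) (ht₀ : t ≠ 0)
    (hq₀ : q ≠ 0) (hq : ‖q‖ < 1) :
    k * (qTheta (k * t) q * qTheta (a / z * t) q * (qTheta a q * qTheta (z / k) q)) -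
        a * (qTheta (a * t) q * qTheta (k / z * t) q * (qTheta k q * qTheta (z / a) q)) +
        a * (qTheta (a * k / z * t) q * qTheta t q * (qTheta z q * qTheta (k / a) q)) = 0 := by
  have hE₀ := qPochInf_self_ne_zero hq
  have hsplit {x y u v : ℂ} (hx₀ : x ≠ 0) (hy₀ : y ≠ 0) (hu : x * y = u) (hv : x / y = v) :
      qTheta x q * qTheta y q =
        x * (y * (squareThetaSeries (q * u) q * squareThetaSeries v q) -
          squareThetaSeries u q * squareThetaSeries (q * v) q) / qPochInf q q ^ 2 := by
    have h := thetaSeries_mul_thetaSeries hx₀ hy₀ hq₀ hq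
    rw [thetaSeries_eq_qPochInf_mul_qTheta hx₀ hq₀ hq,
      thetaSeries_eq_qPochInf_mul_qTheta hy₀ hq₀ hq, hu, hv] at h
    rw [← h, eq_div_iff (pow_ne_zero 2 hE₀)]
    ring
  obtain ⟨u, hu⟩ : ∃ u, u = a * k * t ^ 2 / z := ⟨_, rfl⟩
  obtain ⟨v, hv⟩ : ∃ v, v = k * z / a := ⟨_, rfl⟩
  obtain ⟨w, hw⟩ : ∃ w, w = a * z / k := ⟨_, rfl⟩
  obtain ⟨s, hs⟩ : ∃ s, s = a * k / z := ⟨_, rfl⟩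
  rw [hsplit (x := k * t) (u := u) (v := v), hsplit (x := a) (u := w) (v := s),
    hsplit (x := a * t) (u := u) (v := w), hsplit (x := k) (u := v) (v := s),
    hsplit (y := t) (u := u) (v := s), hsplit (x := z) (u := v) (v := w)]
  · field_simp
    ring
  all_goals first | positivity | (simp only [hu, hv, hw, hs]; field_simp)

end Theta

section ThetaLambert

/-- The bilateral Lambert series of `-x θ'(x) / θ(x)`. Its first part starts at the term
`x / (1 - x)`, whence the argument `x / q`. -/
noncomputable def thetaLambert (x q : ℂ) : ℂ := lambertSeries (x / q) q - lambertSeries x⁻¹ q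

variable {x q : ℂ}

theorem thetaLambert_eq (x : ℂ) (hq₀ : q ≠ 0) (hq : ‖q‖ < 1) :
    thetaLambert x q = x / (1 - x) + lambertSeries x q - lambertSeries x⁻¹ q := by
  have hshift (n : ℕ) : lambertTerm (x / q) q (n + 1) = lambertTerm x q n := by
    rw [add_comm, ← lambertTerm_mul_pow, pow_one, div_mul_cancel₀ _ hq₀]
  rw [thetaLambert, lambertSeries, (summable_lambertTerm (x / q) hq).tsum_eq_zero_add,
    lambertTerm, zero_add, pow_one, div_mul_cancel₀ _ hq₀]
  simp only [hshift, lambertSeries]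

theorem inv_mul_zpow_ne_one (hx : ∀ n : ℤ, x * q ^ n ≠ 1) (n : ℤ) : x⁻¹ * q ^ n ≠ 1 := fun h =>
  hx (-n) <| by rw [zpow_neg, ← inv_inv x, ← mul_inv, h, inv_one]

theorem mul_pow_ne_one_of_zpow (hx : ∀ n : ℤ, x * q ^ n ≠ 1) (n : ℕ) : x * q ^ n ≠ 1 := by
  exact_mod_cast hx n

theorem self_div_mul_pow_ne_one (hx : ∀ n : ℤ, x * q ^ n ≠ 1) (n : ℕ) : q / x * q ^ n ≠ 1 := by
  simpa only [pow_succ', ← mul_assoc, inv_mul_eq_div] using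
    mul_pow_ne_one_of_zpow (inv_mul_zpow_ne_one hx) (n + 1)

theorem qTheta_ne_zero (hq : ‖q‖ < 1) (hx : ∀ n : ℤ, x * q ^ n ≠ 1) : qTheta x q ≠ 0 :=
  mul_ne_zero (qPochInf_ne_zero hq (mul_pow_ne_one_of_zpow hx))
    (qPochInf_ne_zero hq (self_div_mul_pow_ne_one hx))

theorem qTheta_inv (hx₀ : x ≠ 0) (hq : ‖q‖ < 1) : qTheta x⁻¹ q = -x⁻¹ * qTheta x q := by
  rw [qTheta, qTheta, qPochInf_eq_one_sub_mul x⁻¹ hq, qPochInf_eq_one_sub_mul x hq, div_inv_eq_mul,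
    inv_mul_eq_div, mul_comm q x]
  field_simp
  ring

theorem qTheta_one (hq : ‖q‖ < 1) : qTheta 1 q = 0 := by
  rw [qTheta, qPochInf_eq_one_sub_mul 1 hq, sub_self, zero_mul, zero_mul]

theorem differentiableAt_qTheta (hx₀ : x ≠ 0) (hq : ‖q‖ < 1) :
    DifferentiableAt ℂ (qTheta · q) x :=
  (differentiable_qPochInf hq x).mul <|
    (differentiable_qPochInf hq _).comp x ((differentiableAt_const q).div differentiableAt_id hx₀)

theorem hasDerivAt_qTheta_one (hq : ‖q‖ < 1) :
    HasDerivAt (qTheta · q) (-(qPochInf q q * qPochInf q q)) 1 := by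
  have hfactor : DifferentiableAt ℂ (fun x => qPochInf (x * q) q * qPochInf (q / x) q) 1 :=
    ((differentiable_qPochInf hq _).comp (1 : ℂ) (by fun_prop)).mul <|
      (differentiable_qPochInf hq _).comp (1 : ℂ)
        ((differentiableAt_const q).div differentiableAt_id one_ne_zero)
  have hderiv := ((hasDerivAt_id (1 : ℂ)).const_sub 1).mul hfactor.hasDerivAt
  refine (hderiv.congr_deriv (by simp)).congr_of_eventuallyEq (.of_forall fun x => ?_)
  simp only [qTheta, qPochInf_eq_one_sub_mul x hq, mul_assoc, Pi.mul_apply, id]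

theorem hasDerivAt_qPochInf (hx₀ : x ≠ 0) (hq₀ : q ≠ 0) (hq : ‖q‖ < 1)
    (hx : ∀ n : ℕ, x * q ^ n ≠ 1) :
    HasDerivAt (qPochInf · q) (-(qPochInf x q * lambertSeries (x / q) q) / x) x := by
  have hfactor (j : ℕ) :
      logDeriv (fun y : ℂ => 1 - y * q ^ j) x = -x⁻¹ * lambertTerm (x / q) q j := by
    have hd : HasDerivAt (fun y : ℂ => 1 - y * q ^ j) (-(1 * q ^ j)) x :=
      ((hasDerivAt_id x).mul_const _).const_sub 1
    rw [logDeriv_apply, hd.deriv, lambertTerm, pow_succ', ← mul_assoc, div_mul_cancel₀ _ hq₀]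
    field_simp
  have hlog : logDeriv (qPochInf · q) x = -x⁻¹ * lambertSeries (x / q) q := by
    rw [lambertSeries, ← tsum_mul_left]
    simp only [← hfactor]
    refine logDeriv_tprod_eq_tsum isOpen_univ (Set.mem_univ x)
      (fun j => sub_ne_zero.2 (hx j).symm) (fun j => by fun_prop) ?_
      (hasProdLocallyUniformlyOn_qPochInf hq).multipliableLocallyUniformlyOn
      (qPochInf_ne_zero hq hx)
    simpa only [hfactor] using (summable_lambertTerm (x / q) hq).mul_left (-x⁻¹)
  rw [logDeriv_apply, div_eq_iff (qPochInf_ne_zero hq hx)] at hlog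
  refine (differentiable_qPochInf hq x).hasDerivAt.congr_deriv ?_
  rw [hlog]
  ring

theorem hasDerivAt_qTheta_mul (hx₀ : x ≠ 0) (hq₀ : q ≠ 0) (hq : ‖q‖ < 1)
    (hx : ∀ n : ℤ, x * q ^ n ≠ 1) :
    HasDerivAt (fun t => qTheta (x * t) q) (-(qTheta x q * thetaLambert x q)) 1 := by
  have hleft := HasDerivAt.comp_of_eq (1 : ℂ)
    (hasDerivAt_qPochInf hx₀ hq₀ hq (mul_pow_ne_one_of_zpow hx))
    ((hasDerivAt_id (1 : ℂ)).const_mul x) (mul_one x).symm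
  have hright := HasDerivAt.comp_of_eq (1 : ℂ)
    (hasDerivAt_qPochInf (div_ne_zero hq₀ hx₀) hq₀ hq (self_div_mul_pow_ne_one hx))
    ((hasDerivAt_inv one_ne_zero).const_mul (q / x)) (by rw [inv_one, mul_one])
  have hinv : q / x / q = x⁻¹ := by field_simp
  refine ((hleft.mul hright).congr_deriv ?_).congr_of_eventuallyEq (.of_forall fun t => ?_)
  · simp only [qTheta, thetaLambert, hinv, Function.comp_apply, id, inv_one, mul_one]
    field_simp
    ring
  · simp only [qTheta, Pi.mul_apply, Function.comp_apply, id, ← div_eq_mul_inv, div_div]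

/-- The derivative of the three-term relation at `t = 1`, where `θ(t)` vanishes. -/
theorem qTheta_three_term_deriv_one {a k z : ℂ} (ha₀ : a ≠ 0) (hk₀ : k ≠ 0) (hz₀ : z ≠ 0)
    (hq₀ : q ≠ 0) (hq : ‖q‖ < 1) (ha : ∀ n : ℤ, a * q ^ n ≠ 1) (hk : ∀ n : ℤ, k * q ^ n ≠ 1)
    (haz : ∀ n : ℤ, a / z * q ^ n ≠ 1) (hkz : ∀ n : ℤ, k / z * q ^ n ≠ 1) :
    k * (qTheta k q * qTheta (a / z) q * (thetaLambert k q + thetaLambert (a / z) q) *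
          (qTheta a q * qTheta (z / k) q)) -
        a * (qTheta a q * qTheta (k / z) q * (thetaLambert a q + thetaLambert (k / z) q) *
          (qTheta k q * qTheta (z / a) q)) +
        a * (qTheta (a * k / z) q * (qPochInf q q * qPochInf q q) *
          (qTheta z q * qTheta (k / a) q)) = 0 := by
  have hrel : (fun t : ℂ =>
      k * (qTheta (k * t) q * qTheta (a / z * t) q * (qTheta a q * qTheta (z / k) q)) -
        a * (qTheta (a * t) q * qTheta (k / z * t) q * (qTheta k q * qTheta (z / a) q)) +
        a * (qTheta (a * k / z * t) q * qTheta t q * (qTheta z q * qTheta (k / a) q)))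
      =ᶠ[𝓝 1] fun _ => 0 := by
    filter_upwards [isOpen_ne.mem_nhds one_ne_zero] with t ht₀
    exact qTheta_three_term ha₀ hk₀ hz₀ ht₀ hq₀ hq
  have hakz₀ := div_ne_zero (mul_ne_zero ha₀ hk₀) hz₀
  have hakz : DifferentiableAt ℂ (fun t => qTheta (a * k / z * t) q) 1 :=
    (differentiableAt_qTheta (by rwa [mul_one]) hq).comp (1 : ℂ) (by fun_prop)
  have deriv_mul {x : ℂ} (hx₀ : x ≠ 0) (hx : ∀ n : ℤ, x * q ^ n ≠ 1) :=
    hasDerivAt_qTheta_mul hx₀ hq₀ hq hx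
  have hderiv := (((((deriv_mul hk₀ hk).mul (deriv_mul (div_ne_zero ha₀ hz₀) haz)).mul_const
      (qTheta a q * qTheta (z / k) q)).const_mul k).sub
    ((((deriv_mul ha₀ ha).mul (deriv_mul (div_ne_zero hk₀ hz₀) hkz)).mul_const
      (qTheta k q * qTheta (z / a) q)).const_mul a)).add
    (((hakz.hasDerivAt.mul (hasDerivAt_qTheta_one hq)).mul_const
      (qTheta z q * qTheta (k / a) q)).const_mul a)
  have hzero := (hderiv.congr_of_eventuallyEq hrel.symm).unique (hasDerivAt_const (1 : ℂ) (0 : ℂ))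
  simp only [mul_one, qTheta_one hq, mul_zero, zero_add] at hzero
  linear_combination -hzero

theorem thetaLambert_add_sub_sub_eq {a k z : ℂ} (ha₀ : a ≠ 0) (hk₀ : k ≠ 0) (hz₀ : z ≠ 0)
    (hq₀ : q ≠ 0) (hq : ‖q‖ < 1) (ha : ∀ n : ℤ, a * q ^ n ≠ 1) (hk : ∀ n : ℤ, k * q ^ n ≠ 1)
    (hzk : ∀ n : ℤ, z / k * q ^ n ≠ 1) (hza : ∀ n : ℤ, z / a * q ^ n ≠ 1) :
    thetaLambert k q + thetaLambert (a / z) q - thetaLambert (k / z) q - thetaLambert a q =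
      z / k * (qTheta z q * qTheta (k / a) q * qTheta (a * k / z) q *
        (qPochInf q q * qPochInf q q) /
        (qTheta (z / k) q * qTheta (z / a) q * qTheta a q * qTheta k q)) := by
  have hrel := qTheta_three_term_deriv_one ha₀ hk₀ hz₀ hq₀ hq ha hk
    (fun n => inv_div z a ▸ inv_mul_zpow_ne_one hza n)
    (fun n => inv_div z k ▸ inv_mul_zpow_ne_one hzk n)
  have hθa := qTheta_ne_zero hq ha
  have hθk := qTheta_ne_zero hq hk
  have hθza := qTheta_ne_zero hq hza
  have hθzk := qTheta_ne_zero hq hzk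
  rw [← inv_div z a, ← inv_div z k, qTheta_inv (div_ne_zero hz₀ ha₀) hq,
    qTheta_inv (div_ne_zero hz₀ hk₀) hq, inv_div, inv_div] at hrel
  field_simp at hrel ⊢
  refine mul_left_cancel₀ ha₀ ?_
  linear_combination -hrel

end ThetaLambert

section Reciprocity

variable {a k z q : ℂ}

theorem qPochsInf_numerator_eq_qTheta_mul (a k z q : ℂ) :
    qPochsInf [z, q / z, k / a, q * a / k, a * k / z, q * z / (a * k), q, q] q =
      qTheta z q * qTheta (k / a) q * qTheta (a * k / z) q * (qPochInf q q * qPochInf q q) := by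
  simp only [qPochsInf, qTheta, List.map_cons, List.map_nil, List.prod_cons, List.prod_nil,
    div_div_eq_mul_div]
  ring

theorem qPochsInf_denominator_eq_qTheta_mul (a k z q : ℂ) :
    qPochsInf [z / k, q * k / z, z / a, q * a / z, a, q / a, k, q / k] q =
      qTheta (z / k) q * qTheta (z / a) q * qTheta a q * qTheta k q := by
  simp only [qPochsInf, qTheta, List.map_cons, List.map_nil, List.prod_cons, List.prod_nil,
    div_div_eq_mul_div]
  ring

theorem rational_part_eq (hz₀ : z ≠ 0) (ha : a ≠ 1) (hk : k ≠ 1) (hza : z ≠ a) (hzk : z ≠ k) :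
    (a - k) * (1 - 1 / z) * (1 - a * k / z) / ((1 - a) * (1 - k) * (1 - a / z) * (1 - k / z)) =
      a / (1 - a) + k / z / (1 - k / z) - k / (1 - k) - a / z / (1 - a / z) := by
  have h₁ : 1 - a ≠ 0 := sub_ne_zero.2 ha.symm
  have h₂ : 1 - k ≠ 0 := sub_ne_zero.2 hk.symm
  have h₃ : z - a ≠ 0 := sub_ne_zero.2 hza
  have h₄ : z - k ≠ 0 := sub_ne_zero.2 hzk
  rw [one_sub_div (a := a) hz₀, one_sub_div (a := k) hz₀]
  field_simp
  ring

theorem hasSum_fTerm (ha₀ : a ≠ 0) (hz₀ : z ≠ 0) (hq₀ : q ≠ 0) (hq : ‖q‖ < 1)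
    (hk : ∀ n : ℕ, k * q ^ n ≠ 1) (hkz : ∀ n : ℕ, k / z * q ^ (n + 1) ≠ 1)
    (ha : ∀ n : ℕ, a * q ^ (n + 1) ≠ 1) (haz : ‖q * a‖ < ‖z‖) :
    HasSum (fun n => fTerm a k z q (n + 1))
      (lambertSeries k q + lambertSeries (a / z) q - lambertSeries (k / z) q -
        lambertSeries a q) := by
  have haz' : ‖a / z * q‖ < 1 := by
    rwa [div_mul_eq_mul_div, mul_comm, norm_div, div_lt_one (norm_pos_iff.2 hz₀)]
  simpa only [fTerm_eq_vwpTerm hk] using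
    hasSum_vwpTerm ha₀ hz₀ hq₀ hq (fun n => hk (n + 1)) hkz ha haz'

theorem hasSum_fTerm_inv (ha₀ : a ≠ 0) (hz₀ : z ≠ 0) (hq₀ : q ≠ 0) (hq : ‖q‖ < 1)
    (hk : ∀ n : ℕ, k⁻¹ * q ^ n ≠ 1) (hzk : ∀ n : ℕ, z / k * q ^ (n + 1) ≠ 1)
    (ha : ∀ n : ℕ, a⁻¹ * q ^ (n + 1) ≠ 1) (hza : ‖z‖ < ‖a / q‖) :
    HasSum (fun n => fTerm (1 / a) (1 / k) (1 / z) q (n + 1))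
      (lambertSeries k⁻¹ q + lambertSeries (a / z)⁻¹ q - lambertSeries (k / z)⁻¹ q -
        lambertSeries a⁻¹ q) := by
  have hinv (x : ℂ) : x⁻¹ / z⁻¹ = (x / z)⁻¹ := by rw [inv_div_inv, inv_div]
  have hza' : ‖q * a⁻¹‖ < ‖z⁻¹‖ := by
    rw [← div_eq_mul_inv, ← inv_div, norm_inv, norm_inv]
    exact inv_strictAnti₀ (norm_pos_iff.2 hz₀) hza
  simpa only [one_div, hinv] using
    hasSum_fTerm (inv_ne_zero ha₀) (inv_ne_zero hz₀) hq₀ hq hk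
      (by simpa only [hinv, inv_div] using hzk) ha hza'

end Reciprocity

/-- Reciprocity for `f(a, k, z, q)`. The hypotheses `ha`, `hk`, `hzk`, `hza` say that no factor of
`(a, q/a, k, q/k, z/k, qk/z, z/a, qa/z; q)_∞` vanishes; every other denominator in the two series
and in the rational function is a product of such factors and of factors `1 - q ^ n`, `n ≥ 1`. -/
theorem mainTheorem2 (a k z q : ℂ) (hq0 : q ≠ 0) (hq1 : ‖q‖ < 1) (hk0 : k ≠ 0)
    (hz₁ : ‖q * a‖ < ‖z‖) (hz₂ : ‖z‖ < ‖a / q‖)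
    (ha : ∀ n : ℤ, a * q ^ n ≠ 1) (hk : ∀ n : ℤ, k * q ^ n ≠ 1)
    (hzk : ∀ n : ℤ, z / k * q ^ n ≠ 1) (hza : ∀ n : ℤ, z / a * q ^ n ≠ 1) :
    Summable (fun n : ℕ => fTerm a k z q (n + 1)) ∧
    Summable (fun n : ℕ => fTerm (1 / a) (1 / k) (1 / z) q (n + 1)) ∧
    fSeries a k z q - fSeries (1 / a) (1 / k) (1 / z) q =
      (a - k) * (1 - 1 / z) * (1 - a * k / z) /
          ((1 - a) * (1 - k) * (1 - a / z) * (1 - k / z)) +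
        z / k *
          (qPochsInf [z, q / z, k / a, q * a / k, a * k / z, q * z / (a * k), q, q] q /
            qPochsInf [z / k, q * k / z, z / a, q * a / z, a, q / a, k, q / k] q) := by
  have hz₀ : z ≠ 0 := norm_pos_iff.1 ((norm_nonneg _).trans_lt hz₁)
  have ha₀ : a ≠ 0 := (div_ne_zero_iff.1 (norm_pos_iff.1 ((norm_nonneg _).trans_lt hz₂))).1
  have hkz (n : ℤ) : k / z * q ^ n ≠ 1 := inv_div z k ▸ inv_mul_zpow_ne_one hzk n
  have hf := hasSum_fTerm ha₀ hz₀ hq0 hq1 (mul_pow_ne_one_of_zpow hk)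
    (fun n => mul_pow_ne_one_of_zpow hkz (n + 1)) (fun n => mul_pow_ne_one_of_zpow ha (n + 1)) hz₁
  have hf_inv := hasSum_fTerm_inv ha₀ hz₀ hq0 hq1
    (mul_pow_ne_one_of_zpow (inv_mul_zpow_ne_one hk))
    (fun n => mul_pow_ne_one_of_zpow hzk (n + 1))
    (fun n => mul_pow_ne_one_of_zpow (inv_mul_zpow_ne_one ha) (n + 1)) hz₂
  have hne_one {x : ℂ} (hx : ∀ n : ℤ, x * q ^ n ≠ 1) : x ≠ 1 := by simpa using hx 0
  have hrational := rational_part_eq hz₀ (hne_one ha) (hne_one hk)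
    (fun h => hne_one hza (by rw [h, div_self ha₀]))
    (fun h => hne_one hzk (by rw [h, div_self hk0]))
  refine ⟨hf.summable, hf_inv.summable, ?_⟩
  rw [fSeries, fSeries, hf.tsum_eq, hf_inv.tsum_eq, hrational, qPochsInf_numerator_eq_qTheta_mul,
    qPochsInf_denominator_eq_qTheta_mul,
    ← thetaLambert_add_sub_sub_eq ha₀ hk0 hz₀ hq0 hq1 ha hk hzk hza]
  simp only [thetaLambert_eq _ hq0 hq1]
  ring
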